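/- Let $(W_i)_{i\in\mathbb N}$ be the standard enumeration of the computably enumerable subsets of $\mathbb N\times\mathbb N$ (domains of the partial computable functions), and let $E_i$ be the equivalence relation on $\mathbb N$ generated by $W_i$, so that $(E_i)_{i\in\mathbb N}$ is the natural effective uniform enumeration of all ceers (computably enumerable equivalence relations on $\mathbb N$). For equivalence relations $E,F$ on $\mathbb N$ write $E\le F$ if there is a total computable function $f$ such that $x\mathrel{E}y\iff f(x)\mathrel{F}f(y)$ for all $x,y$, and write $E\equiv F$ if $E\le F$ and $F\le E$. For $S\subseteq\mathbb N$ let $[S]=\{i : \exists j\in S\ (E_i\equiv E_j)\}$. Say that $S$ is proper on the infinite ceers if there are $i\in[S]$ and $j\notin[S]$ such that $E_i$ and $E_j$ both have infinitely many equivalence classes. **Theorem.** If $S\subseteq\mathbb N$ is $\Sigma^0_3$ and proper on the infinite ceers, then $[S]$ is $\Sigma^0_3$-complete; that is, $[S]$ is $\Sigma^0_3$, and every $\Sigma^0_3$ set $U\subseteq\mathbb N$ is one-one reducible to $[S]$ (there is an injective computable $h:\mathbb N\to\mathbb N$ with $n\in U\iff h(n)\in[S]$ for all $n$). -/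

import Mathlib

/-- The `i`-th computably enumerable set of pairs of natural numbers: the domain of the `i`-th
partial computable function, under the standard pairing `ℕ × ℕ ≃ ℕ`. -/
def cePair (i x y : ℕ) : Prop :=
  ((Denumerable.ofNat Nat.Partrec.Code i).eval (Nat.pair x y)).Dom

/-- The natural effective uniform enumeration `E_i` of all ceers: `E_i` is the equivalence relation
on `ℕ` generated by the `i`-th computably enumerable set of pairs. -/
def ceer (i : ℕ) : Setoid ℕ :=
  Relation.EqvGen.setoid (cePair i)

/-- Computable reducibility `E ≤ F` of equivalence relations on `ℕ`. -/
def CompReduces (E F : Setoid ℕ) : Prop :=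
  ∃ f : ℕ → ℕ, Computable f ∧ ∀ x y : ℕ, E x y ↔ F (f x) (f y)

/-- Computable equivalence `E ≡ F` of equivalence relations on `ℕ`. -/
def CompEquiv (E F : Setoid ℕ) : Prop :=
  CompReduces E F ∧ CompReduces F E

/-- The closure `[S]` of a set of indices of ceers under computable equivalence. -/
def ceerClosure (S : Set ℕ) : Set ℕ :=
  {i | ∃ j ∈ S, CompEquiv (ceer i) (ceer j)}

/-- `S` is proper on the infinite ceers: `[S]` contains some but not all indices of ceers with
infinitely many classes. -/
def ProperOnInfiniteCeers (S : Set ℕ) : Prop :=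
  ∃ i j : ℕ, Infinite (Quotient (ceer i)) ∧ Infinite (Quotient (ceer j)) ∧
    i ∈ ceerClosure S ∧ j ∉ ceerClosure S

/-- `A` is a `Σ⁰₃` set of natural numbers. -/
def IsSigma03 (A : Set ℕ) : Prop :=
  ∃ P : ℕ × ℕ × ℕ × ℕ → Prop, ComputablePred P ∧
    ∀ n : ℕ, n ∈ A ↔ ∃ x : ℕ, ∀ y : ℕ, ∃ z : ℕ, P (n, x, y, z)

/-- `A` is `Σ⁰₃`-complete: it is `Σ⁰₃` and every `Σ⁰₃` set is one-one reducible to it (hence also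
many-one reducible to it). -/
def IsSigma03Complete (A : Set ℕ) : Prop :=
  IsSigma03 A ∧ ∀ B : Set ℕ, IsSigma03 B → (fun n => n ∈ B) ≤₁ (fun n => n ∈ A)

/-!
The closure `[S]` is `Σ⁰₃` by counting quantifiers: being a reduction between two ceers is a `Π⁰₂`
property of a program (`Ceer.compReduces_iff`, `IsSigma03.ceerClosure`).

For hardness, fix ceers `A` in `[S]` and `B` outside `[S]`, both with infinitely many classes, and
a `Σ⁰₃` set `U`. Both `n ∈ U` and `i ∈ [S]` say that some `x` satisfies a `Π⁰₂` condition, that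
is, that a computable event associated with `x` occurs infinitely often. By the recursion theorem
(`Ceer.exists_self_referential_ceer`) the ceer `E` with index `i = h n` may be built with
knowledge of `i`. It has two strategies for each `x`: an even one, acting when `x` gains evidence
for `n ∈ U` and trying to make `E` equivalent to `A`, and an odd one, acting when `x` gains
evidence for `i ∈ [S]` and trying to make `E` equivalent to `B`. If any strategy acts infinitely
often, the least such wins (`Ceer.compEquiv_of_isLimit_priorityMerge`). An odd strategy cannot
win, for then `E` would be in `[S]` and equivalent to `B`. Hence if `n ∈ U`, an even strategy wins
and `E ≡ A` is in `[S]`. If `n ∉ U`, even strategies act finitely often, so no odd strategy acts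
infinitely often either, which means that `i ∉ [S]`.

The construction is a finite injury argument. Classes of an equivalence relation are numbered
without gaps in the order of their least elements, and a ceer is a sequence of mergers of two
numbered classes (`Ceer.classIndex`). Strategy `k` simply performs on `E` the same mergers, by
class numbers, as those that produce its ceer, except that it skips those that would move a class
protected by a strategy of higher priority. Once the strategies of higher priority have stopped
acting and the last proper merger has been skipped, class `i` of `E` corresponds to class `i` of the
copied ceer (`Ceer.compEquiv_of_synchronized`). Infinitely many classes are needed exactly to know
that only finitely many proper mergers are skipped (`Ceer.IsLimit.eventually_protected`).
-/

namespace Ceer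

/-! ### Numbered classes and mergers -/

/-- Renumbering of classes after two of them are merged. If the classes of an equivalence relation
are numbered by `ℕ` without gaps, merging the classes `p.1` and `p.2` gives the merged class the
smaller of the two numbers, moves every class beyond the larger one down by one, and leaves
everything below the larger one in place. If `p.1 = p.2` nothing happens. -/
def collapse (p : ℕ × ℕ) (x : ℕ) : ℕ :=
  if x < max p.1 p.2 ∨ p.1 = p.2 then x else if x = max p.1 p.2 then min p.1 p.2 else x - 1

theorem collapse_le (p : ℕ × ℕ) (x : ℕ) : collapse p x ≤ x := by
  unfold collapse; split_ifs <;> omega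

theorem collapse_of_lt {p : ℕ × ℕ} {x : ℕ} (h : x < max p.1 p.2) : collapse p x = x := by
  simp [collapse, h]

theorem collapse_of_eq {p : ℕ × ℕ} (h : p.1 = p.2) (x : ℕ) : collapse p x = x := by
  simp [collapse, h]

theorem collapse_lt {p : ℕ × ℕ} {x : ℕ} (hne : p.1 ≠ p.2) (h : max p.1 p.2 ≤ x) :
    collapse p x < x := by
  unfold collapse; split_ifs <;> omega

theorem collapse_surjective (p : ℕ × ℕ) : Function.Surjective (collapse p) := by
  intro y
  by_cases h : y < max p.1 p.2 ∨ p.1 = p.2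
  · exact ⟨y, by simp only [collapse, h, if_true]⟩
  · refine ⟨y + 1, ?_⟩
    unfold collapse
    split_ifs <;> omega

theorem collapse_eq_collapse_iff {p : ℕ × ℕ} {x y : ℕ} : collapse p x = collapse p y ↔
    x = y ∨ (x = p.1 ∧ y = p.2) ∨ (x = p.2 ∧ y = p.1) := by
  unfold collapse
  split_ifs <;> omega

/-- Starting from equality on `ℕ`, merge at each stage `m < n` the two classes numbered by `ω m`;
`classIndex ω n x` is the number of the class of `x` after these `n` mergers. -/
def classIndex (ω : ℕ → ℕ × ℕ) : ℕ → ℕ → ℕ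
  | 0, x => x
  | n + 1, x => collapse (ω n) (classIndex ω n x)

theorem classIndex_antitone (ω : ℕ → ℕ × ℕ) (x : ℕ) : Antitone fun n => classIndex ω n x :=
  antitone_nat_of_succ_le fun _ => collapse_le _ _

theorem classIndex_surjective (ω : ℕ → ℕ × ℕ) (n : ℕ) : Function.Surjective (classIndex ω n) := by
  induction n with
  | zero => exact fun y => ⟨y, rfl⟩
  | succ n ih => exact (collapse_surjective (ω n)).comp ih

theorem classIndex_eq_mono {ω : ℕ → ℕ × ℕ} {m n x y : ℕ} (hmn : m ≤ n)
    (h : classIndex ω m x = classIndex ω m y) : classIndex ω n x = classIndex ω n y := by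
  induction n, hmn using Nat.le_induction with
  | base => exact h
  | succ n _ ih => simp only [classIndex, ih]

/-- `E` is the union over all stages of the equivalence relations obtained by the mergers `ω`. -/
def IsLimit (ω : ℕ → ℕ × ℕ) (E : Setoid ℕ) : Prop :=
  ∀ x y, E x y ↔ ∃ n, classIndex ω n x = classIndex ω n y

/-- If the limit has infinitely many classes, then from some stage on every proper merger leaves
the classes numbered below `P` in place. Otherwise every number at least `P` would be lowered
infinitely often, so all elements would end up in the first `P` classes. -/
theorem IsLimit.eventually_protected {ω : ℕ → ℕ × ℕ} {E : Setoid ℕ} (hE : IsLimit ω E)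
    (hinf : Infinite (Quotient E)) (P : ℕ) :
    ∃ n₀, ∀ n ≥ n₀, (ω n).1 = (ω n).2 ∨ P ≤ max (ω n).1 (ω n).2 := by
  by_contra! hcon
  have hsmall : ∀ b x n, classIndex ω n x ≤ b → ∃ n', classIndex ω n' x < P := by
    intro b
    induction b with
    | zero =>
      intro x n hn
      obtain ⟨m, -, -, hm⟩ := hcon n
      exact ⟨n, by omega⟩
    | succ b ih =>
      intro x n hn
      obtain ⟨m, hm, hne, hlt⟩ := hcon n
      by_cases hP : classIndex ω m x < P
      · exact ⟨m, hP⟩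
      · refine ih x (m + 1) ?_
        have h1 : classIndex ω (m + 1) x < classIndex ω m x := collapse_lt hne (by omega)
        have h2 : classIndex ω m x ≤ classIndex ω n x := classIndex_antitone ω x hm
        omega
  -- `P + 1` inequivalent elements would eventually all lie in `P` classes.
  choose t ht using fun x => hsmall x x 0 le_rfl
  let r : ℕ → ℕ := fun i => (Infinite.natEmbedding (Quotient E) i).out
  let T := (Finset.range (P + 1)).sup fun i => t (r i)
  obtain ⟨i, hi, j, hj, hij, heq⟩ := Finset.exists_ne_map_eq_of_card_lt_of_maps_to
    (s := Finset.range (P + 1)) (t := Finset.range P) (f := fun i => classIndex ω T (r i))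
    (by simp) (by
      intro i hi
      have h1 : t (r i) ≤ T := Finset.le_sup (f := fun i => t (r i)) hi
      exact Finset.mem_coe.2 (Finset.mem_range.2
        ((classIndex_antitone ω (r i) h1).trans_lt (ht (r i)))))
  have hE' : E (r i) (r j) := (hE _ _).2 ⟨T, heq⟩
  apply hij
  apply (Infinite.natEmbedding (Quotient E)).injective
  rw [← Quotient.out_eq (Infinite.natEmbedding (Quotient E) i),
    ← Quotient.out_eq (Infinite.natEmbedding (Quotient E) j)]
  exact Quotient.sound hE'

/-! ### Computability of the class numbers -/

theorem primrec_collapse : Primrec₂ collapse := by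
  have h1 : Primrec fun q : (ℕ × ℕ) × ℕ => max q.1.1 q.1.2 :=
    Primrec.nat_max.comp (Primrec.fst.comp Primrec.fst) (Primrec.snd.comp Primrec.fst)
  have h2 : Primrec fun q : (ℕ × ℕ) × ℕ => min q.1.1 q.1.2 :=
    Primrec.nat_min.comp (Primrec.fst.comp Primrec.fst) (Primrec.snd.comp Primrec.fst)
  have h : Primrec fun q : (ℕ × ℕ) × ℕ => collapse q.1 q.2 :=
    Primrec.ite ((Primrec.nat_lt.comp Primrec.snd h1).or
      (Primrec.eq.comp (Primrec.fst.comp Primrec.fst) (Primrec.snd.comp Primrec.fst))) Primrec.snd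
      (Primrec.ite (Primrec.eq.comp Primrec.snd h1) h2
        (Primrec.nat_sub.comp Primrec.snd (Primrec.const 1)))
  exact h

theorem computable_classIndex {α : Type*} [Primcodable α] {ω : α → ℕ → ℕ × ℕ}
    (hω : Computable₂ ω) {f : α → ℕ} {g : α → ℕ} (hf : Computable f) (hg : Computable g) :
    Computable fun a => classIndex (ω a) (f a) (g a) := by
  refine (Computable.nat_rec (h := fun a q => collapse (ω a q.1) q.2) hf hg
    (primrec_collapse.to_comp.comp (hω.comp Computable.fst (Computable.fst.comp Computable.snd))
      (Computable.snd.comp Computable.snd)).to₂).of_eq fun a => ?_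
  induction f a with
  | zero => rfl
  | succ n ih => simp only [classIndex, ← ih]

theorem computable_decide_eq {α : Type*} [Primcodable α] {f g : α → ℕ}
    (hf : Computable f) (hg : Computable g) : Computable fun a => decide (f a = g a) :=
  Primrec.eq.decide.to_comp.comp hf hg

theorem computable_decide_lt {α : Type*} [Primcodable α] {f g : α → ℕ}
    (hf : Computable f) (hg : Computable g) : Computable fun a => decide (f a < g a) :=
  Primrec.nat_lt.decide.to_comp.comp hf hg

/-! ### Synchronized mergers give equivalent relations -/

/-- A semidecidable correspondence that is defined everywhere and respects the two relations gives
a reduction: search for a partner `x` of `a` together with a witness `v` of `d`. -/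
theorem compReduces_of_search {E F : Setoid ℕ} {d : ℕ → ℕ → ℕ → Bool}
    (hd : Computable fun q : ℕ × ℕ × ℕ => d q.1 q.2.1 q.2.2)
    (htot : ∀ a, ∃ x v, d a x v = true)
    (hcompat : ∀ a b x y v w, d a x v = true → d b y w = true → (E a b ↔ F x y)) :
    CompReduces E F := by
  have hex : ∀ a, ∃ m : ℕ, d a m.unpair.1 m.unpair.2 = true := fun a => by
    obtain ⟨x, v, h⟩ := htot a
    exact ⟨Nat.pair x v, by simpa using h⟩
  have hp : Partrec fun a : ℕ => Nat.rfind fun m => Part.some (d a m.unpair.1 m.unpair.2) :=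
    Partrec.rfind (Computable.partrec (f := fun q : ℕ × ℕ => d q.1 q.2.unpair.1 q.2.unpair.2)
      (hd.comp (Computable.pair Computable.fst (Computable.unpair.comp Computable.snd)))).to₂
  have hc : Computable fun a => Nat.find (hex a) := hp.of_eq_tot fun a => by
    refine Nat.mem_rfind.2 ⟨by simpa using (Nat.find_spec (hex a)).symm, fun hm => ?_⟩
    simpa using (Nat.find_min (hex a) hm)
  exact ⟨fun a => (Nat.find (hex a)).unpair.1,
    Computable.fst.comp (Computable.unpair.comp hc),
    fun a b => hcompat _ _ _ _ _ _ (Nat.find_spec (hex a)) (Nat.find_spec (hex b))⟩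

/-- If, from stage `V` on, every merger of `ω` either is performed on `ρ` as well, whose clock `N`
then advances, or leaves the classes below the bound `Q` in place, and if `Q` and `N` tend to
infinity, then the two limits are equivalent. Class number `i` of the one relation is matched with
class number `i` of the other as soon as `i < Q`. The matching persists, and since both numberings
are surjective at every stage, it meets every class on both sides. What happened before stage `V`
is irrelevant. -/
theorem compEquiv_of_synchronized {E F : Setoid ℕ} {ω ρ : ℕ → ℕ × ℕ} (hE : IsLimit ω E)
    (hF : IsLimit ρ F) (hω : Computable ω) (hρ : Computable ρ) {N Q : ℕ → ℕ}
    (hN : Computable N) (hQ : Computable Q) (hQmono : Monotone Q) (hQtop : ∀ b, ∃ v, b < Q v)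
    (hNmono : Monotone N) (hNtop : ∀ b, ∃ v, b ≤ N v) (V : ℕ)
    (hstep : ∀ v ≥ V, (N (v + 1) = N v + 1 ∧ ∀ x, collapse (ω v) x = collapse (ρ (N v)) x) ∨
      (N (v + 1) = N v ∧ ∀ x < Q v, collapse (ω v) x = x)) :
    CompEquiv E F := by
  obtain ⟨d, hd, hdiff⟩ : ∃ d : ℕ → ℕ → ℕ → Bool,
      (Computable fun q : ℕ × ℕ × ℕ => d q.1 q.2.1 q.2.2) ∧ ∀ x a v, d x a v = true ↔
        classIndex ω (V + v) x = classIndex ρ (N (V + v)) a ∧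
          classIndex ω (V + v) x < Q (V + v) := by
    refine ⟨fun x a v => decide (classIndex ω (V + v) x = classIndex ρ (N (V + v)) a) &&
      decide (classIndex ω (V + v) x < Q (V + v)), ?_, fun x a v => by simp⟩
    have hv : Computable fun q : ℕ × ℕ × ℕ => V + q.2.2 :=
      Primrec.nat_add.to_comp.comp (Computable.const V) (Computable.snd.comp Computable.snd)
    have h1 : Computable fun q : ℕ × ℕ × ℕ => classIndex ω (V + q.2.2) q.1 :=
      computable_classIndex (ω := fun _ => ω) (hω.comp Computable.snd).to₂ hv Computable.fst
    have h2 : Computable fun q : ℕ × ℕ × ℕ => classIndex ρ (N (V + q.2.2)) q.2.1 :=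
      computable_classIndex (ω := fun _ => ρ) (hρ.comp Computable.snd).to₂ (hN.comp hv)
        (Computable.fst.comp Computable.snd)
    exact Primrec.and.to_comp.comp (computable_decide_eq h1 h2)
      (computable_decide_lt h1 (hQ.comp hv))
  -- Matched classes stay matched: class numbers only decrease, and `Q` only increases.
  have hpersist : ∀ x a v w, V ≤ v → v ≤ w →
      (classIndex ω v x = classIndex ρ (N v) a ∧ classIndex ω v x < Q v) →
      (classIndex ω w x = classIndex ρ (N w) a ∧ classIndex ω w x < Q w) := by
    intro x a v w hv hvw h
    induction w, hvw using Nat.le_induction with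
    | base => exact h
    | succ w hvw ih =>
      obtain ⟨ih1, ih2⟩ := ih
      refine ⟨?_, ((classIndex_antitone ω x w.le_succ).trans_lt ih2).trans_le
        (hQmono w.le_succ)⟩
      rcases hstep w (hv.trans hvw) with ⟨h1, h2⟩ | ⟨h1, h2⟩
      · rw [h1, classIndex, classIndex, h2, ih1]
      · rw [h1, classIndex, h2 _ ih2, ih1]
  have hcompat : ∀ x y a b v w, d x a v = true → d y b w = true → (E x y ↔ F a b) := by
    intro x y a b v w hxa hyb
    rw [hdiff] at hxa hyb
    have hx := fun u hu => hpersist x a _ u (Nat.le_add_right V v) hu hxa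
    have hy := fun u hu => hpersist y b _ u (Nat.le_add_right V w) hu hyb
    rw [hE, hF]
    constructor
    · rintro ⟨n, hn⟩
      refine ⟨N (max n (max (V + v) (V + w))), ?_⟩
      rw [← (hx _ (by omega)).1, ← (hy _ (by omega)).1]
      exact classIndex_eq_mono (by omega) hn
    · rintro ⟨n, hn⟩
      obtain ⟨u, hu⟩ := hNtop n
      refine ⟨max u (max (V + v) (V + w)), ?_⟩
      rw [(hx _ (by omega)).1, (hy _ (by omega)).1]
      exact classIndex_eq_mono (hu.trans (hNmono (by omega))) hn
  have hbig : ∀ b, ∃ v, b < Q (V + v) := fun b => by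
    obtain ⟨v, hv⟩ := hQtop b
    exact ⟨v, hv.trans_le (hQmono (Nat.le_add_left v V))⟩
  constructor
  · refine compReduces_of_search hd (fun x => ?_) hcompat
    obtain ⟨v, hv⟩ := hbig x
    obtain ⟨a, ha⟩ := classIndex_surjective ρ (N (V + v)) (classIndex ω (V + v) x)
    exact ⟨a, v, (hdiff _ _ _).2
      ⟨ha.symm, (classIndex_antitone ω x (Nat.zero_le (V + v))).trans_lt hv⟩⟩
  · have hswap : Computable fun q : ℕ × ℕ × ℕ => (q.2.1, q.1, q.2.2) :=
      Computable.pair (Computable.fst.comp Computable.snd)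
        (Computable.pair Computable.fst (Computable.snd.comp Computable.snd))
    have hd' : Computable fun q : ℕ × ℕ × ℕ => d q.2.1 q.1 q.2.2 :=
      (hd.comp hswap).of_eq fun _ => rfl
    have htot : ∀ a, ∃ x v, d x a v = true := fun a => by
      obtain ⟨v, hv⟩ := hbig a
      obtain ⟨x, hx⟩ := classIndex_surjective ω (V + v) (classIndex ρ (N (V + v)) a)
      exact ⟨x, v, (hdiff _ _ _).2
        ⟨hx, hx ▸ (classIndex_antitone ρ a (Nat.zero_le (N (V + v)))).trans_lt hv⟩⟩
    exact compReduces_of_search (d := fun a x v => d x a v) hd' htot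
      fun a b x y v w h1 h2 => (hcompat x y a b v w h1 h2).symm

/-! ### Ceers as limits of mergers -/

/-- A computable enumeration of generators of `ceer i`: `t` codes a number of steps and a pair,
which is returned if the `i`-th program halts on it within that number of steps; otherwise the
trivial pair `(0, 0)` is returned. -/
def enumPair (i t : ℕ) : ℕ × ℕ :=
  bif (Nat.Partrec.Code.evaln t.unpair.1 (Denumerable.ofNat Nat.Partrec.Code i) t.unpair.2).isSome
  then t.unpair.2.unpair else (0, 0)

theorem ceer_enumPair (i t : ℕ) : ceer i (enumPair i t).1 (enumPair i t).2 := by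
  unfold enumPair
  cases h : (Nat.Partrec.Code.evaln t.unpair.1 (Denumerable.ofNat Nat.Partrec.Code i)
    t.unpair.2).isSome
  · exact (ceer i).refl _
  · obtain ⟨z, hz⟩ := Option.isSome_iff_exists.1 h
    refine Relation.EqvGen.rel _ _ ?_
    simp only [cond_true, cePair, Nat.pair_unpair]
    exact Part.dom_iff_mem.2 ⟨z, Nat.Partrec.Code.evaln_sound hz⟩

theorem exists_enumPair {i x y : ℕ} (h : cePair i x y) : ∃ t, enumPair i t = (x, y) := by
  obtain ⟨z, hz⟩ := Part.dom_iff_mem.1 h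
  obtain ⟨k, hk⟩ := Nat.Partrec.Code.evaln_complete.1 hz
  refine ⟨Nat.pair k (Nat.pair x y), ?_⟩
  simp only [enumPair, Nat.unpair_pair, Option.mem_def.1 hk, Option.isSome_some, cond_true]

/-- The first `n` mergers producing `ceer i`, latest first. The list serves as the state of the
recursion, because the next merger needs the class numbers of two elements at once. -/
def mergeList (i : ℕ) : ℕ → List (ℕ × ℕ)
  | 0 => []
  | n + 1 => ((mergeList i n).foldr collapse (enumPair i n).1,
      (mergeList i n).foldr collapse (enumPair i n).2) :: mergeList i n

/-- The `n`-th merger producing `ceer i`: it joins the current classes of the two elements of the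
`n`-th enumerated pair. -/
def merges (i n : ℕ) : ℕ × ℕ :=
  ((mergeList i n).foldr collapse (enumPair i n).1,
    (mergeList i n).foldr collapse (enumPair i n).2)

theorem foldr_mergeList (i n x : ℕ) :
    (mergeList i n).foldr collapse x = classIndex (merges i) n x := by
  induction n with
  | zero => rfl
  | succ n ih => rw [classIndex, ← ih]; rfl

theorem merges_eq (i n : ℕ) : merges i n =
    (classIndex (merges i) n (enumPair i n).1, classIndex (merges i) n (enumPair i n).2) := by
  rw [← foldr_mergeList, ← foldr_mergeList]; rfl

theorem isLimit_merges (i : ℕ) : IsLimit (merges i) (ceer i) := by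
  intro x y
  constructor
  · intro h
    induction h with
    | rel x y h =>
      obtain ⟨t, ht⟩ := exists_enumPair h
      refine ⟨t + 1, collapse_eq_collapse_iff.2 ?_⟩
      rw [merges_eq, ht]
      exact Or.inr (Or.inl ⟨rfl, rfl⟩)
    | refl x => exact ⟨0, rfl⟩
    | symm x y _ ih => exact ih.imp fun _ => Eq.symm
    | trans x y z _ _ ih1 ih2 =>
      obtain ⟨m, hm⟩ := ih1
      obtain ⟨n, hn⟩ := ih2
      exact ⟨max m n, (classIndex_eq_mono (le_max_left m n) hm).trans
        (classIndex_eq_mono (le_max_right m n) hn)⟩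
  · rintro ⟨n, hn⟩
    induction n generalizing x y with
    | zero =>
      obtain rfl : x = y := hn
      exact (ceer i).refl x
    | succ n ih =>
      have hg := ceer_enumPair i n
      rcases collapse_eq_collapse_iff.1 hn with h | ⟨hx, hy⟩ | ⟨hx, hy⟩
      · exact ih x y h
      · rw [merges_eq] at hx hy
        exact (ceer i).trans (ih _ _ hx) ((ceer i).trans hg (ih _ _ hy.symm))
      · rw [merges_eq] at hx hy
        exact (ceer i).trans (ih _ _ hx) ((ceer i).trans ((ceer i).symm hg) (ih _ _ hy.symm))

theorem computable_enumPair : Computable₂ enumPair := by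
  have h1 : Primrec fun q : ℕ × ℕ => q.2.unpair := Primrec.unpair.comp Primrec.snd
  have h2 : Primrec fun q : ℕ × ℕ => Denumerable.ofNat Nat.Partrec.Code q.1 :=
    (Primrec.ofNat _).comp Primrec.fst
  have h3 : Primrec fun q : ℕ × ℕ => Nat.Partrec.Code.evaln q.2.unpair.1
      (Denumerable.ofNat Nat.Partrec.Code q.1) q.2.unpair.2 :=
    Nat.Partrec.Code.primrec_evaln.comp
      (Primrec.pair (Primrec.pair (Primrec.fst.comp h1) h2) (Primrec.snd.comp h1))
  exact (Primrec.cond (Primrec.option_isSome.comp h3)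
    (Primrec.unpair.comp (Primrec.snd.comp h1)) (Primrec.const (0, 0))).to_comp

theorem computable_foldr_collapse :
    Computable₂ fun (l : List (ℕ × ℕ)) (x : ℕ) => l.foldr collapse x := by
  exact (Primrec.list_foldr (h := fun (_ : List (ℕ × ℕ) × ℕ) q => collapse q.1 q.2)
    Primrec.fst Primrec.snd
    (primrec_collapse.comp (Primrec.fst.comp Primrec.snd) (Primrec.snd.comp
      Primrec.snd)).to₂).to_comp

theorem computable_mergeList : Computable₂ mergeList := by
  have hl : Computable fun q : (ℕ × ℕ) × ℕ × List (ℕ × ℕ) => q.2.2 :=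
    Computable.snd.comp Computable.snd
  have hg : Computable fun q : (ℕ × ℕ) × ℕ × List (ℕ × ℕ) => enumPair q.1.1 q.2.1 :=
    computable_enumPair.comp (Computable.fst.comp Computable.fst)
      (Computable.fst.comp Computable.snd)
  refine (Computable.nat_rec (f := fun q : ℕ × ℕ => q.2) (g := fun _ => [])
    (h := fun q s => (s.2.foldr collapse (enumPair q.1 s.1).1,
      s.2.foldr collapse (enumPair q.1 s.1).2) :: s.2) Computable.snd (Computable.const [])
    (Computable.list_cons.comp (Computable.pair
      (computable_foldr_collapse.comp hl (Computable.fst.comp hg))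
      (computable_foldr_collapse.comp hl (Computable.snd.comp hg))) hl).to₂).of_eq fun q => ?_
  obtain ⟨i, n⟩ := q
  induction n with
  | zero => rfl
  | succ n ih => simp only [mergeList, ← ih]

theorem computable_merges : Computable₂ merges :=
  Computable.pair
    (computable_foldr_collapse.comp computable_mergeList (Computable.fst.comp computable_enumPair))
    (computable_foldr_collapse.comp computable_mergeList (Computable.snd.comp computable_enumPair))

/-! ### The priority construction -/

theorem computable_count {α : Type*} [Primcodable α] {p : α → ℕ → Prop} [∀ a, DecidablePred (p a)]
    {f : α → ℕ} (hp : Computable fun q : α × ℕ => decide (p q.1 q.2)) (hf : Computable f) :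
    Computable fun a => Nat.count (p a) (f a) := by
  refine (Computable.nat_rec (g := fun _ => 0)
    (h := fun a q => bif decide (p a q.1) then q.2 + 1 else q.2) hf (Computable.const 0)
    (Computable.cond (hp.comp (Computable.pair Computable.fst (Computable.fst.comp Computable.snd)))
      (Computable.succ.comp (Computable.snd.comp Computable.snd))
      (Computable.snd.comp Computable.snd)).to₂).of_eq fun a => ?_
  induction f a with
  | zero => rfl
  | succ n ih =>
    simp only [Nat.count_succ, ← ih]
    by_cases h : p a n <;> simp [h]

/-- The priority construction for a schedule `σ`, where strategy `k` copies `ceer (R k)`. At stage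
`v` strategy `σ v` performs the next merger of its ceer (its clock is the number of its earlier
turns), unless this would move a class whose number is below the number of earlier turns of
strategies of higher priority; then the merger is skipped. -/
def priorityMerge (R σ : ℕ → ℕ) (v : ℕ) : ℕ × ℕ :=
  let p := merges (R (σ v)) (Nat.count (fun u => σ u = σ v) v)
  bif decide (max p.1 p.2 < Nat.count (fun u => σ u < σ v) v) then (0, 0) else p

theorem computable_priorityMerge {α : Type*} [Primcodable α] {R : ℕ → ℕ} {σ : α → ℕ → ℕ}
    (hR : Computable R) (hσ : Computable₂ σ) : Computable₂ fun a => priorityMerge R (σ a) := by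
  have hσ1 : Computable fun q : α × ℕ => σ q.1 q.2 := hσ
  have hσ2 : Computable fun q : (α × ℕ) × ℕ => σ q.1.1 q.2 :=
    hσ.comp (Computable.fst.comp Computable.fst) Computable.snd
  have hσ3 : Computable fun q : (α × ℕ) × ℕ => σ q.1.1 q.1.2 := hσ1.comp Computable.fst
  have hp : Computable fun q : α × ℕ =>
      merges (R (σ q.1 q.2)) (Nat.count (fun u => σ q.1 u = σ q.1 q.2) q.2) :=
    computable_merges.comp (hR.comp hσ1)
      (computable_count (p := fun (q : α × ℕ) u => σ q.1 u = σ q.1 q.2)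
        (computable_decide_eq hσ2 hσ3) Computable.snd)
  have hc : Computable fun q : α × ℕ => Nat.count (fun u => σ q.1 u < σ q.1 q.2) q.2 :=
    computable_count (p := fun (q : α × ℕ) u => σ q.1 u < σ q.1 q.2)
      (computable_decide_lt hσ2 hσ3) Computable.snd
  exact Computable.cond (computable_decide_lt
    (Primrec.nat_max.to_comp.comp (Computable.fst.comp hp) (Computable.snd.comp hp)) hc)
    (Computable.const (0, 0)) hp

/-- If `k` is the least strategy whose turn comes infinitely often, then the construction yields a
relation equivalent to `ceer (R k)`. The strategies of higher priority protect only finitely many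
classes, and as `ceer (R k)` has infinitely many classes, only finitely many of its proper mergers
are skipped; the strategies of lower priority respect ever more classes. Skipped mergers do no harm,
as the matching of classes may start at any stage. -/
theorem compEquiv_of_isLimit_priorityMerge {E : Setoid ℕ} {R σ : ℕ → ℕ} (hR : Computable R)
    (hσ : Computable σ) (hE : IsLimit (priorityMerge R σ) E) {k : ℕ}
    (hk : {v | σ v = k}.Infinite) (hlow : ∀ m < k, {v | σ v = m}.Finite)
    (hinf : Infinite (Quotient (ceer (R k)))) : CompEquiv E (ceer (R k)) := by
  have hfin : {v | σ v < k}.Finite :=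
    ((Set.finite_Iio k).biUnion hlow).subset fun v hv => Set.mem_biUnion (Set.mem_Iio.2 hv) rfl
  obtain ⟨V₁, hV₁⟩ := hfin.bddAbove
  have hle : ∀ v > V₁, k ≤ σ v := fun v hv => by
    by_contra! h
    exact absurd (hV₁ h) (by omega)
  have hP : ∀ v > V₁, Nat.count (fun u => σ u < k) v = Nat.count (fun u => σ u < k) (V₁ + 1) := by
    intro v hv
    induction v, hv using Nat.le_induction with
    | base => rfl
    | succ v hv ih => rw [Nat.count_succ, ih, if_neg (not_lt.2 (hle v hv)), add_zero]
  -- After stage `V₁` the protection imposed on strategy `k` is constant.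
  obtain ⟨n₀, hn₀⟩ := (isLimit_merges (R k)).eventually_protected hinf
    (Nat.count (fun u => σ u < k) (V₁ + 1))
  have hNtop : ∀ b, ∃ v, b ≤ Nat.count (fun u => σ u = k) v := fun b =>
    ⟨Nat.nth (fun u => σ u = k) b, (Nat.count_nth_of_infinite hk b).ge⟩
  obtain ⟨V₂, hV₂⟩ := hNtop n₀
  have hQN : ∀ v, Nat.count (fun u => σ u = k) v ≤ Nat.count (fun u => σ u < k + 1) v := fun v =>
    Nat.count_mono_left fun u _ hu => by omega
  refine compEquiv_of_synchronized hE (isLimit_merges (R k))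
    ((computable_priorityMerge (α := Unit) (σ := fun _ => σ) hR (hσ.comp Computable.snd).to₂).comp
      (Computable.const ()) Computable.id)
    (computable_merges.comp (Computable.const (R k)) Computable.id)
    (N := Nat.count fun u => σ u = k) (Q := Nat.count fun u => σ u < k + 1)
    (computable_count (p := fun (_ : ℕ) u => σ u = k)
      (computable_decide_eq (hσ.comp Computable.snd) (Computable.const k)) Computable.id)
    (computable_count (p := fun (_ : ℕ) u => σ u < k + 1)
      (computable_decide_lt (hσ.comp Computable.snd) (Computable.const (k + 1))) Computable.id)
    (Nat.count_monotone _) (fun b => (hNtop (b + 1)).imp fun v hv => lt_of_lt_of_le hv (hQN v))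
    (Nat.count_monotone _) hNtop (max (V₁ + 1) V₂) fun v hv => ?_
  have hv₁ : V₁ < v := by omega
  rcases eq_or_ne (σ v) k with hvk | hvk
  · refine Or.inl ⟨by rw [Nat.count_succ, if_pos hvk], fun x => ?_⟩
    have hn := hn₀ _ (hV₂.trans (Nat.count_monotone (fun u => σ u = k)
      ((le_max_right _ _).trans hv)))
    simp only [priorityMerge, hvk, hP v hv₁]
    rcases hn with hn | hn
    · rw [collapse_of_eq hn]
      have htriv : ∀ b : Bool, collapse (bif b then (0, 0) else
          merges (R k) (Nat.count (fun u => σ u = k) v)) x = x := fun b => by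
        cases b
        · exact collapse_of_eq hn x
        · exact collapse_of_eq rfl x
      exact htriv _
    · rw [decide_eq_false (not_lt.2 hn), cond_false]
  · have hlt : k + 1 ≤ σ v := lt_of_le_of_ne (hle v hv₁) hvk.symm
    refine Or.inr ⟨by rw [Nat.count_succ, if_neg hvk, add_zero], fun x hx => ?_⟩
    have hx' : x < Nat.count (fun u => σ u < σ v) v :=
      hx.trans_le (Nat.count_mono_left fun u _ hu => by omega)
    unfold priorityMerge
    by_cases hm : max (merges (R (σ v)) (Nat.count (fun u => σ u = σ v) v)).1
      (merges (R (σ v)) (Nat.count (fun u => σ u = σ v) v)).2 < Nat.count (fun u => σ u < σ v) v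
    · simp only [decide_eq_true hm, cond_true]
      exact collapse_of_eq rfl x
    · simp only [decide_eq_false hm, cond_false]
      exact collapse_of_lt (hx'.trans_le (not_lt.1 hm))

/-! ### Schedules from `Π⁰₂` conditions -/

/-- State of the search that checks `∀ y, ∃ z, d y z`: the `y` under consideration and the next
candidate for `z`. -/
def searchState (d : ℕ → ℕ → Bool) : ℕ → ℕ × ℕ
  | 0 => (0, 0)
  | t + 1 => bif d (searchState d t).1 (searchState d t).2 then ((searchState d t).1 + 1, 0)
      else ((searchState d t).1, (searchState d t).2 + 1)

/-- Whether the search for `∀ y, ∃ z, d y z` finds a witness at step `t`. -/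
def fires (d : ℕ → ℕ → Bool) (t : ℕ) : Bool :=
  d (searchState d t).1 (searchState d t).2

theorem infinite_fires_iff (d : ℕ → ℕ → Bool) :
    {t | fires d t = true}.Infinite ↔ ∀ y, ∃ z, d y z = true := by
  have hsucc : ∀ t, fires d t = true → searchState d (t + 1) = ((searchState d t).1 + 1, 0) :=
    fun t ht => by rw [fires] at ht; simp [searchState, ht]
  have hsucc' : ∀ t, ¬ fires d t = true →
      searchState d (t + 1) = ((searchState d t).1, (searchState d t).2 + 1) :=
    fun t ht => by rw [fires] at ht; simp [searchState, ht]
  constructor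
  · intro h
    have hlow : ∀ t, ∀ y < (searchState d t).1, ∃ z, d y z = true := by
      intro t
      induction t with
      | zero => intro y hy; exact absurd hy (Nat.not_lt_zero y)
      | succ t ih =>
        intro y hy
        by_cases ht : fires d t = true
        · rw [hsucc t ht] at hy
          rcases Nat.lt_succ_iff_lt_or_eq.1 hy with hy | rfl
          · exact ih y hy
          · exact ⟨_, ht⟩
        · rw [hsucc' t ht] at hy
          exact ih y hy
    have hmono : Monotone fun t => (searchState d t).1 := monotone_nat_of_le_succ fun t => by
      by_cases ht : fires d t = true
      · rw [hsucc t ht]; exact Nat.le_succ _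
      · rw [hsucc' t ht]
    have hunb : ∀ y, ∃ t, y ≤ (searchState d t).1 := by
      intro y
      induction y with
      | zero => exact ⟨0, Nat.zero_le _⟩
      | succ y ih =>
        obtain ⟨t, ht⟩ := ih
        obtain ⟨s, hs, hts⟩ := h.exists_gt t
        refine ⟨s + 1, ?_⟩
        rw [hsucc s hs]
        exact Nat.succ_le_succ (ht.trans (hmono hts.le))
    intro y
    obtain ⟨t, ht⟩ := hunb (y + 1)
    exact hlow t y ht
  · intro h
    have hfail : ∀ t, ∀ z < (searchState d t).2, ¬ d (searchState d t).1 z = true := by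
      intro t
      induction t with
      | zero => intro z hz; exact absurd hz (Nat.not_lt_zero z)
      | succ t ih =>
        by_cases ht : fires d t = true
        · rw [hsucc t ht]; intro z hz; exact absurd hz (Nat.not_lt_zero z)
        · rw [hsucc' t ht]
          intro z hz
          rcases Nat.lt_succ_iff_lt_or_eq.1 hz with hz | rfl
          · exact ih z hz
          · exact ht
    refine Set.infinite_of_not_bddAbove fun ⟨T, hT⟩ => ?_
    have hno : ∀ s, searchState d (T + 1 + s) =
        ((searchState d (T + 1)).1, (searchState d (T + 1)).2 + s) := by
      intro s
      induction s with
      | zero => rfl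
      | succ s ih =>
        rw [← Nat.add_assoc, hsucc', ih]
        · rfl
        · intro hf
          have := hT hf
          omega
    obtain ⟨z, hz⟩ := h (searchState d (T + 1)).1
    refine hfail (T + 1 + (z + 1)) z ?_ ?_
    · rw [hno]; simp only; omega
    · rw [hno]; exact hz

/-- A schedule giving strategy `m` a turn at stage `Nat.pair m t` whenever the search for `∀ y, ∃
z, D m y z` finds a witness at step `t`. Idle stages `v` are given to strategy `v`, which adds at
most one turn to each strategy. -/
def schedule (D : ℕ → ℕ → ℕ → Bool) (v : ℕ) : ℕ :=
  bif fires (D v.unpair.1) v.unpair.2 then v.unpair.1 else v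

theorem infinite_schedule_iff (D : ℕ → ℕ → ℕ → Bool) (m : ℕ) :
    {v | schedule D v = m}.Infinite ↔ ∀ y, ∃ z, D m y z = true := by
  rw [← infinite_fires_iff]
  constructor
  · intro h hfin
    refine h (((Set.not_infinite.1 (not_not.2 hfin)).image (Nat.pair m) |>.union
      (Set.finite_singleton m)).subset fun v hv => ?_)
    change schedule D v = m at hv
    unfold schedule at hv
    cases hf : fires (D v.unpair.1) v.unpair.2
    · rw [hf, cond_false] at hv
      exact Or.inr hv
    · rw [hf, cond_true] at hv
      refine Or.inl ⟨v.unpair.2, ?_, ?_⟩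
      · rw [hv] at hf; exact hf
      · rw [← hv, Nat.pair_unpair]
  · intro h
    refine (h.image (f := Nat.pair m) fun a _ b _ hab => (Nat.pair_eq_pair.1 hab).2).mono ?_
    rintro _ ⟨t, ht, rfl⟩
    change fires (D m) t = true at ht
    simp [schedule, ht]

theorem computable_schedule {α : Type*} [Primcodable α] {D : α → ℕ → ℕ → ℕ → Bool}
    (hD : Computable fun q : α × ℕ × ℕ × ℕ => D q.1 q.2.1 q.2.2.1 q.2.2.2) :
    Computable₂ fun a => schedule (D a) := by
  have hstep : Computable fun q : (α × ℕ) × ℕ × ℕ × ℕ => D q.1.1 q.1.2.unpair.1 q.2.2.1 q.2.2.2 :=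
    hD.comp (Computable.pair (Computable.fst.comp Computable.fst)
      (Computable.pair (Computable.fst.comp (Computable.unpair.comp
        (Computable.snd.comp Computable.fst))) (Computable.snd.comp Computable.snd)))
  have hy : Computable fun q : (α × ℕ) × ℕ × ℕ × ℕ => q.2.2.1 :=
    Computable.fst.comp (Computable.snd.comp Computable.snd)
  have hz : Computable fun q : (α × ℕ) × ℕ × ℕ × ℕ => q.2.2.2 :=
    Computable.snd.comp (Computable.snd.comp Computable.snd)
  have hu : Computable fun q : α × ℕ => q.2.unpair := Computable.unpair.comp Computable.snd
  have hst : Computable fun q : α × ℕ => searchState (D q.1 q.2.unpair.1) q.2.unpair.2 := by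
    refine (Computable.nat_rec (g := fun _ => ((0, 0) : ℕ × ℕ))
      (h := fun (q : α × ℕ) s => bif D q.1 q.2.unpair.1 s.2.1 s.2.2 then (s.2.1 + 1, 0)
        else (s.2.1, s.2.2 + 1)) (Computable.snd.comp hu) (Computable.const (0, 0))
      (Computable.cond hstep (Computable.pair (Computable.succ.comp hy) (Computable.const 0))
        (Computable.pair hy (Computable.succ.comp hz))).to₂).of_eq fun q => ?_
    induction q.2.unpair.2 with
    | zero => rfl
    | succ n ih => simp only [searchState, ← ih]
  have hf : Computable fun q : α × ℕ => fires (D q.1 q.2.unpair.1) q.2.unpair.2 :=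
    (hD.comp (Computable.pair Computable.fst (Computable.pair (Computable.fst.comp hu) hst))).of_eq
      fun _ => rfl
  exact Computable.cond hf (Computable.fst.comp hu) Computable.snd

/-! ### Ceers that know their own index -/

/-- By the recursion theorem, a uniform family of merger sequences may refer to the index of the
ceer that it produces. The index function is injective because `Code.curry` is. -/
theorem exists_self_referential_ceer {ω : ℕ × ℕ → ℕ → ℕ × ℕ} (hω : Computable₂ ω) :
    ∃ h : ℕ → ℕ, Computable h ∧ Function.Injective h ∧
      ∀ n, IsLimit (ω (n, h n)) (ceer (h n)) := by
  let index : Nat.Partrec.Code → ℕ → ℕ := fun c n => Encodable.encode (Nat.Partrec.Code.curry c n)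
  have hindex : Computable₂ index :=
    (Primrec.encode.comp Nat.Partrec.Code.primrec₂_curry).to_comp
  have hF : Partrec₂ fun (c : Nat.Partrec.Code) (m : ℕ) => Nat.rfind fun v => Part.some
      (decide (classIndex (ω (m.unpair.1, index c m.unpair.1)) v m.unpair.2.unpair.1 =
        classIndex (ω (m.unpair.1, index c m.unpair.1)) v m.unpair.2.unpair.2)) := by
    have hm : Computable fun q : (Nat.Partrec.Code × ℕ) × ℕ => q.1.2.unpair :=
      Computable.unpair.comp (Computable.snd.comp Computable.fst)
    have hxy : Computable fun q : (Nat.Partrec.Code × ℕ) × ℕ => q.1.2.unpair.2.unpair :=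
      Computable.unpair.comp (Computable.snd.comp hm)
    have hω' : Computable₂ fun (q : (Nat.Partrec.Code × ℕ) × ℕ) v =>
        ω (q.1.2.unpair.1, index q.1.1 q.1.2.unpair.1) v :=
      hω.comp (Computable.pair (Computable.fst.comp (hm.comp Computable.fst))
        (hindex.comp (Computable.fst.comp (Computable.fst.comp Computable.fst))
          (Computable.fst.comp (hm.comp Computable.fst)))) Computable.snd
    exact Partrec.rfind (Computable.partrec (computable_decide_eq
      (computable_classIndex hω' Computable.snd (Computable.fst.comp hxy))
      (computable_classIndex hω' Computable.snd (Computable.snd.comp hxy)))).to₂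
  obtain ⟨c, hc⟩ := Nat.Partrec.Code.fixed_point₂ hF
  refine ⟨index c, hindex.comp (Computable.const c) Computable.id, fun a b hab =>
    (Nat.Partrec.Code.curry_inj (Encodable.encode_injective hab)).2, fun n x y => ?_⟩
  have hpair : ∀ x y, cePair (index c n) x y ↔ ∃ v, classIndex (ω (n, index c n)) v x =
      classIndex (ω (n, index c n)) v y := by
    intro x y
    rw [cePair, Denumerable.ofNat_encode, Nat.Partrec.Code.eval_curry, hc]
    refine Nat.rfind_dom.trans ?_
    simp
  have hequiv : Equivalence (cePair (index c n)) := by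
    refine ⟨fun x => (hpair x x).2 ⟨0, rfl⟩, fun {x y} h => ?_, fun {x y z} h₁ h₂ => ?_⟩
    · exact (hpair y x).2 (((hpair x y).1 h).imp fun _ => Eq.symm)
    · obtain ⟨a, ha⟩ := (hpair x y).1 h₁
      obtain ⟨b, hb⟩ := (hpair y z).1 h₂
      exact (hpair x z).2 ⟨max a b, (classIndex_eq_mono (le_max_left a b) ha).trans
        (classIndex_eq_mono (le_max_right a b) hb)⟩
  exact hequiv.eqvGen_iff.trans (hpair x y)

/-! ### The closure of a `Σ⁰₃` set under equivalence is `Σ⁰₃` -/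

theorem _root_.CompReduces.trans {E F G : Setoid ℕ} (h₁ : CompReduces E F) (h₂ : CompReduces F G) :
    CompReduces E G := by
  obtain ⟨f, hf, hf'⟩ := h₁
  obtain ⟨g, hg, hg'⟩ := h₂
  exact ⟨fun x => g (f x), hg.comp hf, fun x y => (hf' x y).trans (hg' _ _)⟩

theorem _root_.CompEquiv.symm {E F : Setoid ℕ} (h : CompEquiv E F) : CompEquiv F E := ⟨h.2, h.1⟩

theorem _root_.CompEquiv.trans {E F G : Setoid ℕ} (h₁ : CompEquiv E F) (h₂ : CompEquiv F G) :
    CompEquiv E G :=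
  ⟨h₁.1.trans h₂.1, h₂.2.trans h₁.2⟩

theorem mem_ceerClosure_of_compEquiv {S : Set ℕ} {i j : ℕ} (h : CompEquiv (ceer i) (ceer j))
    (hj : j ∈ ceerClosure S) : i ∈ ceerClosure S := by
  obtain ⟨l, hl, hjl⟩ := hj
  exact ⟨l, hl, h.trans hjl⟩

theorem _root_.IsSigma03.exists_bool {A : Set ℕ} (h : IsSigma03 A) :
    ∃ d : ℕ → ℕ → ℕ → ℕ → Bool, (Computable fun q : ℕ × ℕ × ℕ × ℕ => d q.1 q.2.1 q.2.2.1 q.2.2.2) ∧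
      ∀ n, n ∈ A ↔ ∃ x, ∀ y, ∃ z, d n x y z = true := by
  obtain ⟨P, ⟨hdec, hP⟩, hA⟩ := h
  refine ⟨fun n x y z => decide (P (n, x, y, z)), hP, fun n => (hA n).trans ?_⟩
  simp only [decide_eq_true_eq]

/-- Whether `x` and `y` are equivalent at stage `s` of the enumeration of `ceer i`. -/
def mergedBy (i s x y : ℕ) : Bool :=
  decide (classIndex (merges i) s x = classIndex (merges i) s y)

theorem ceer_iff_mergedBy (i x y : ℕ) : ceer i x y ↔ ∃ s, mergedBy i s x y = true := by
  simp only [mergedBy, decide_eq_true_eq]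
  exact isLimit_merges i x y

theorem mergedBy_mono {i s t x y : ℕ} (hst : s ≤ t) (h : mergedBy i s x y = true) :
    mergedBy i t x y = true := by
  simp only [mergedBy, decide_eq_true_eq] at h ⊢
  exact classIndex_eq_mono hst h

theorem computable_mergedBy {α : Type*} [Primcodable α] {i s x y : α → ℕ} (hi : Computable i)
    (hs : Computable s) (hx : Computable x) (hy : Computable y) :
    Computable fun a => mergedBy (i a) (s a) (x a) (y a) := by
  have hω : Computable₂ fun a n => merges (i a) n :=
    computable_merges.comp (hi.comp Computable.fst) Computable.snd
  exact computable_decide_eq (computable_classIndex hω hs hx) (computable_classIndex hω hs hy)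

/-- The value of the `e`-th program at `x`, if it halts within `t` steps. -/
def evalBy (e t x : ℕ) : Option ℕ :=
  Nat.Partrec.Code.evaln t (Denumerable.ofNat Nat.Partrec.Code e) x

theorem computable_evalBy {α : Type*} [Primcodable α] {e t x : α → ℕ} (he : Computable e)
    (ht : Computable t) (hx : Computable x) : Computable fun a => evalBy (e a) (t a) (x a) :=
  Nat.Partrec.Code.primrec_evaln.to_comp.comp
    (Computable.pair (Computable.pair ht ((Computable.ofNat _).comp he)) hx)

/-- Stage `t` confirms that the `e`-th program, at the arguments `a` and `b`, is defined and
respects whatever is known about equivalence of `a` and `b`, and of their values, at stage `s`.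
Reductions from `ceer i` to `ceer j` are the programs for which every `(a, b, s)` is confirmed at
some `t`, a `Π⁰₂` condition. -/
def reductionCheck (i j e a b s t : ℕ) : Bool :=
  (evalBy e t a).isSome && (evalBy e t b).isSome &&
    (!mergedBy i s a b || mergedBy j t ((evalBy e t a).getD 0) ((evalBy e t b).getD 0)) &&
    (!mergedBy j s ((evalBy e t a).getD 0) ((evalBy e t b).getD 0) || mergedBy i t a b)

theorem computable_reductionCheck {α : Type*} [Primcodable α] {i j e a b s t : α → ℕ}
    (hi : Computable i) (hj : Computable j) (he : Computable e) (ha : Computable a)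
    (hb : Computable b) (hs : Computable s) (ht : Computable t) :
    Computable fun q => reductionCheck (i q) (j q) (e q) (a q) (b q) (s q) (t q) := by
  have h1 := computable_evalBy he ht ha
  have h2 := computable_evalBy he ht hb
  have h1' := Computable.option_getD h1 (Computable.const 0)
  have h2' := Computable.option_getD h2 (Computable.const 0)
  have hsome := (Primrec.option_isSome (α := ℕ)).to_comp
  have hand := Primrec.and.to_comp
  have hor := Primrec.or.to_comp
  have hnot := Primrec.not.to_comp
  exact hand.comp (hand.comp (hand.comp (hsome.comp h1) (hsome.comp h2))
    (hor.comp (hnot.comp (computable_mergedBy hi hs ha hb)) (computable_mergedBy hj ht h1' h2')))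
    (hor.comp (hnot.comp (computable_mergedBy hj hs h1' h2')) (computable_mergedBy hi ht ha hb))

theorem compReduces_iff (i j : ℕ) : CompReduces (ceer i) (ceer j) ↔
    ∃ e, ∀ a b s, ∃ t, reductionCheck i j e a b s t = true := by
  constructor
  · rintro ⟨f, hf, hred⟩
    obtain ⟨c, hc⟩ := Nat.Partrec.Code.exists_code.1 (Partrec.nat_iff.1 hf.partrec)
    have hev : ∀ x, ∃ k, ∀ t ≥ k, evalBy (Encodable.encode c) t x = some (f x) := by
      intro x
      have hx : f x ∈ c.eval x := by rw [hc]; exact Part.mem_some _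
      obtain ⟨k, hk⟩ := Nat.Partrec.Code.evaln_complete.1 hx
      refine ⟨k, fun t ht => ?_⟩
      rw [evalBy, Denumerable.ofNat_encode]
      exact Nat.Partrec.Code.evaln_mono ht hk
    refine ⟨Encodable.encode c, fun a b s => ?_⟩
    obtain ⟨ka, hka⟩ := hev a
    obtain ⟨kb, hkb⟩ := hev b
    obtain ⟨k, hk⟩ : ∃ k, ∀ t ≥ k, ceer i a b → mergedBy i t a b = true ∧
        mergedBy j t (f a) (f b) = true := by
      by_cases hab : ceer i a b
      · obtain ⟨k₁, hk₁⟩ := (ceer_iff_mergedBy _ _ _).1 hab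
        obtain ⟨k₂, hk₂⟩ := (ceer_iff_mergedBy _ _ _).1 ((hred a b).1 hab)
        exact ⟨max k₁ k₂, fun t ht _ => ⟨mergedBy_mono (by omega) hk₁,
          mergedBy_mono (by omega) hk₂⟩⟩
      · exact ⟨0, fun _ _ h => absurd h hab⟩
    refine ⟨max (max ka kb) k, ?_⟩
    have hk' := hk (max (max ka kb) k) (le_max_right _ _)
    simp only [reductionCheck, hka (max (max ka kb) k) (by omega),
      hkb (max (max ka kb) k) (by omega), Option.isSome_some, Option.getD_some, Bool.and_eq_true,
      Bool.or_eq_true, Bool.not_eq_true', true_and]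
    constructor
    · by_cases hm : mergedBy i s a b = true
      · exact Or.inr (hk' ((ceer_iff_mergedBy _ _ _).2 ⟨s, hm⟩)).2
      · exact Or.inl (Bool.eq_false_iff.2 hm)
    · by_cases hm : mergedBy j s (f a) (f b) = true
      · exact Or.inr (hk' ((hred a b).2 ((ceer_iff_mergedBy _ _ _).2 ⟨s, hm⟩))).1
      · exact Or.inl (Bool.eq_false_iff.2 hm)
  · rintro ⟨e, he⟩
    simp only [reductionCheck, Bool.and_eq_true, Bool.or_eq_true, Bool.not_eq_true'] at he
    set c := Denumerable.ofNat Nat.Partrec.Code e with hc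
    have htot : ∀ a, ∃ u, u ∈ c.eval a := fun a => by
      obtain ⟨t, ⟨⟨h1, -⟩, -⟩, -⟩ := he a a 0
      obtain ⟨u, hu⟩ := Option.isSome_iff_exists.1 h1
      exact ⟨u, Nat.Partrec.Code.evaln_sound hu⟩
    choose f hf using htot
    have hval : ∀ t a, (evalBy e t a).isSome = true → evalBy e t a = some (f a) := by
      intro t a h
      obtain ⟨u, hu⟩ := Option.isSome_iff_exists.1 h
      rw [hu, Part.mem_unique (hf a) (Nat.Partrec.Code.evaln_sound hu)]
    refine ⟨f, Partrec.of_eq_tot (Partrec.nat_iff.2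
      (Nat.Partrec.Code.exists_code.2 ⟨c, rfl⟩)) hf, fun a b => ⟨fun h => ?_, fun h => ?_⟩⟩
    · obtain ⟨s, hs⟩ := (ceer_iff_mergedBy _ _ _).1 h
      obtain ⟨t, ⟨⟨h1, h2⟩, h3⟩, -⟩ := he a b s
      rw [hval _ _ h1, hval _ _ h2, hs] at h3
      exact (ceer_iff_mergedBy _ _ _).2 ⟨t, by simpa using h3⟩
    · obtain ⟨s, hs⟩ := (ceer_iff_mergedBy _ _ _).1 h
      obtain ⟨t, ⟨⟨h1, h2⟩, -⟩, h3⟩ := he a b s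
      rw [hval _ _ h1, hval _ _ h2, Option.getD_some, Option.getD_some, hs] at h3
      exact (ceer_iff_mergedBy _ _ _).2 ⟨t, by simpa using h3⟩

theorem _root_.IsSigma03.ceerClosure {S : Set ℕ} (hS : IsSigma03 S) :
    IsSigma03 (ceerClosure S) := by
  obtain ⟨d, hd, hS⟩ := hS.exists_bool
  let fst : ℕ → ℕ := fun m => m.unpair.1
  let snd : ℕ → ℕ := fun m => m.unpair.2
  have hfst : Computable fst := Computable.fst.comp Computable.unpair
  have hsnd : Computable snd := Computable.snd.comp Computable.unpair
  -- `X` codes an index `j`, a witness for `j ∈ S` and programs for the two reductions; the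
  -- conjunction of three `∀∃` conditions is again one, as `Y` may be read in two ways and `Z` codes
  -- three witnesses.
  let check : ℕ → ℕ → ℕ → ℕ → Bool := fun i X Y Z =>
    d (fst X) (fst (snd X)) Y (fst Z) &&
      (reductionCheck i (fst X) (fst (snd (snd X))) (fst Y) (fst (snd Y)) (snd (snd Y))
        (fst (snd Z)) &&
      reductionCheck (fst X) i (snd (snd (snd X))) (fst Y) (fst (snd Y)) (snd (snd Y))
        (snd (snd Z)))
  have hcheck : Computable fun q : ℕ × ℕ × ℕ × ℕ => check q.1 q.2.1 q.2.2.1 q.2.2.2 := by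
    have hX : Computable fun q : ℕ × ℕ × ℕ × ℕ => q.2.1 := Computable.fst.comp Computable.snd
    have hY : Computable fun q : ℕ × ℕ × ℕ × ℕ => q.2.2.1 :=
      Computable.fst.comp (Computable.snd.comp Computable.snd)
    have hZ : Computable fun q : ℕ × ℕ × ℕ × ℕ => q.2.2.2 :=
      Computable.snd.comp (Computable.snd.comp Computable.snd)
    have hj := hfst.comp hX
    have ha := hfst.comp hY
    have hb := hfst.comp (hsnd.comp hY)
    have hs := hsnd.comp (hsnd.comp hY)
    have hd' : Computable fun q : ℕ × ℕ × ℕ × ℕ =>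
        d (fst q.2.1) (fst (snd q.2.1)) q.2.2.1 (fst q.2.2.2) :=
      (hd.comp (Computable.pair hj (Computable.pair (hfst.comp (hsnd.comp hX))
        (Computable.pair hY (hfst.comp hZ))))).of_eq fun _ => rfl
    exact Primrec.and.to_comp.comp hd' (Primrec.and.to_comp.comp
      (computable_reductionCheck Computable.fst hj (hfst.comp (hsnd.comp (hsnd.comp hX))) ha hb hs
        (hfst.comp (hsnd.comp hZ)))
      (computable_reductionCheck hj Computable.fst (hsnd.comp (hsnd.comp (hsnd.comp hX))) ha hb hs
        (hsnd.comp (hsnd.comp hZ))))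
  refine ⟨fun q => check q.1 q.2.1 q.2.2.1 q.2.2.2 = true, ⟨inferInstance, hcheck.of_eq fun _ => by
    simp⟩, fun i => ?_⟩
  constructor
  · rintro ⟨j, hj, h₁, h₂⟩
    obtain ⟨x, hx⟩ := (hS j).1 hj
    obtain ⟨e, he⟩ := (compReduces_iff i j).1 h₁
    obtain ⟨e', he'⟩ := (compReduces_iff j i).1 h₂
    refine ⟨Nat.pair j (Nat.pair x (Nat.pair e e')), fun Y => ?_⟩
    obtain ⟨z, hz⟩ := hx Y
    obtain ⟨t, ht⟩ := he (fst Y) (fst (snd Y)) (snd (snd Y))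
    obtain ⟨t', ht'⟩ := he' (fst Y) (fst (snd Y)) (snd (snd Y))
    refine ⟨Nat.pair z (Nat.pair t t'), ?_⟩
    simp only [check, fst, snd, Nat.unpair_pair, Bool.and_eq_true]
    exact ⟨hz, ht, ht'⟩
  · rintro ⟨X, hX⟩
    simp only [check, Bool.and_eq_true] at hX
    refine ⟨fst X, (hS _).2 ⟨fst (snd X), fun y => ?_⟩, (compReduces_iff _ _).2
      ⟨fst (snd (snd X)), fun a b s => ?_⟩, (compReduces_iff _ _).2
      ⟨snd (snd (snd X)), fun a b s => ?_⟩⟩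
    · obtain ⟨Z, hZ, -⟩ := hX y
      exact ⟨_, hZ⟩
    · obtain ⟨Z, -, hZ, -⟩ := hX (Nat.pair a (Nat.pair b s))
      refine ⟨fst (snd Z), ?_⟩
      simpa only [fst, snd, Nat.unpair_pair] using hZ
    · obtain ⟨Z, -, -, hZ⟩ := hX (Nat.pair a (Nat.pair b s))
      refine ⟨snd (snd Z), ?_⟩
      simpa only [fst, snd, Nat.unpair_pair] using hZ

end Ceer

/-! ### Hardness -/

theorem theorem3p1 (S : Set ℕ) (hS : IsSigma03 S) (hproper : ProperOnInfiniteCeers S) :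
    IsSigma03Complete (ceerClosure S) := by
  have hcl := hS.ceerClosure
  refine ⟨hcl, fun U hU => ?_⟩
  obtain ⟨a, b, hainf, hbinf, ha, hb⟩ := hproper
  obtain ⟨dU, hdU, hU⟩ := hU.exists_bool
  obtain ⟨dS, hdS, hcl⟩ := hcl.exists_bool
  -- Strategy `2 * x` acts if `x` witnesses `n ∈ U`, strategy `2 * x + 1` if `x` witnesses
  -- `h n ∈ [S]`; here `p = (n, h n)`.
  let D : ℕ × ℕ → ℕ → ℕ → ℕ → Bool := fun p m y z =>
    bif m.bodd then dS p.2 m.div2 y z else dU p.1 m.div2 y z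
  let R : ℕ → ℕ := fun m => bif m.bodd then b else a
  have hD : Computable fun q : (ℕ × ℕ) × ℕ × ℕ × ℕ => D q.1 q.2.1 q.2.2.1 q.2.2.2 := by
    have hm : Computable fun q : (ℕ × ℕ) × ℕ × ℕ × ℕ => q.2.1 := Computable.fst.comp Computable.snd
    have hyz : Computable fun q : (ℕ × ℕ) × ℕ × ℕ × ℕ => q.2.2 := Computable.snd.comp Computable.snd
    have h₁ : Computable fun q : (ℕ × ℕ) × ℕ × ℕ × ℕ => dS q.1.2 q.2.1.div2 q.2.2.1 q.2.2.2 :=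
      (hdS.comp (Computable.pair (Computable.snd.comp Computable.fst)
        (Computable.pair (Computable.nat_div2.comp hm) hyz))).of_eq fun _ => rfl
    have h₂ : Computable fun q : (ℕ × ℕ) × ℕ × ℕ × ℕ => dU q.1.1 q.2.1.div2 q.2.2.1 q.2.2.2 :=
      (hdU.comp (Computable.pair (Computable.fst.comp Computable.fst)
        (Computable.pair (Computable.nat_div2.comp hm) hyz))).of_eq fun _ => rfl
    exact Computable.cond (Computable.nat_bodd.comp hm) h₁ h₂
  have hR : Computable R :=
    Computable.cond Computable.nat_bodd (Computable.const b) (Computable.const a)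
  have hσ : Computable₂ fun p => Ceer.schedule (D p) := Ceer.computable_schedule hD
  obtain ⟨h, hcomp, hinj, hlim⟩ :=
    Ceer.exists_self_referential_ceer (Ceer.computable_priorityMerge hR hσ)
  refine ⟨h, hcomp, hinj, fun n => ?_⟩
  change n ∈ U ↔ h n ∈ ceerClosure S
  have hRinf : ∀ m, Infinite (Quotient (ceer (R m))) := fun m => by
    cases hm : m.bodd
    · simpa only [R, hm, cond_false] using hainf
    · simpa only [R, hm, cond_true] using hbinf
  -- If some strategy acts infinitely often, then the least such is even: an odd one would make
  -- `ceer (h n)`, which it certifies to be in `[S]`, equivalent to `ceer b`, which is not.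
  have key : (∃ m, ∀ y, ∃ z, D (n, h n) m y z = true) → ∃ m, m.bodd = false ∧
      (∀ y, ∃ z, D (n, h n) m y z = true) ∧ CompEquiv (ceer (h n)) (ceer a) := by
    classical
    intro hex
    have hspec := Nat.find_spec hex
    have hE : CompEquiv (ceer (h n)) (ceer (R (Nat.find hex))) :=
      Ceer.compEquiv_of_isLimit_priorityMerge hR (hσ.comp (Computable.const (n, h n)) Computable.id)
        (hlim n) ((Ceer.infinite_schedule_iff _ _).2 hspec)
        (fun m hm => Set.not_infinite.1 fun hi =>
          Nat.find_min hex hm ((Ceer.infinite_schedule_iff _ _).1 hi)) (hRinf _)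
    cases hm : (Nat.find hex).bodd
    · refine ⟨Nat.find hex, hm, hspec, ?_⟩
      simpa only [R, hm, cond_false] using hE
    · exfalso
      simp only [R, hm, cond_true] at hE
      simp only [D, hm, cond_true] at hspec
      exact hb (Ceer.mem_ceerClosure_of_compEquiv hE.symm ((hcl (h n)).2 ⟨_, hspec⟩))
  constructor
  · intro hn
    obtain ⟨x, hx⟩ := (hU n).1 hn
    obtain ⟨-, -, -, hE⟩ := key ⟨2 * x, by simpa [D] using hx⟩
    exact Ceer.mem_ceerClosure_of_compEquiv hE ha
  · intro hn
    obtain ⟨x, hx⟩ := (hcl (h n)).1 hn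
    obtain ⟨m, hm, hspec, -⟩ := key ⟨2 * x + 1, by simpa [D] using hx⟩
    simp only [D, hm, cond_false] at hspec
    exact (hU n).2 ⟨_, hspec⟩
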